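/- Let $K$ be an infinite field, let $S=K[x_1,\ldots,x_n]$ be the polynomial ring with its standard grading, and let $\mathfrak m=(x_1,\ldots,x_n)$. For an $\mathfrak m$-primary graded ideal $I\subset S$, the algebra $A=S/I$ is said to have the weak Lefschetz property if there is a linear form $l\in A_1$ such that for every $i\in\mathbb N=\{0,1,2,\ldots\}$ the multiplication map $A_i\to A_{i+1}$, $f\mapsto lf$, has maximal rank, that is, is injective or surjective. It is said to have the strong Lefschetz property if there is $l\in A_1$ such that for all $i\in\mathbb N$ and all $k\ge 1$ the map $A_i\to A_{i+k}$, $f\mapsto l^kf$, has maximal rank. Let $I\subset S$ be an $\mathfrak m$-primary graded ideal and let $J$ be the initial ideal of $I$ with respect to a term order $\tau$ on $S$, that is, the ideal generated by the leading terms with respect to $\tau$ of the elements of $I$. If $S/J$ has the weak (resp. strong) Lefschetz property, then $S/I$ has the weak (resp. strong) Lefschetz property. -/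

import Mathlib

open MvPolynomial

attribute [local instance] MvPolynomial.gradedAlgebra

noncomputable section

/-- The initial ideal of `I` with respect to a term order: the ideal generated by the leading
terms of the elements of `I` (the leading term of `0` being `0`). -/
def initialIdeal {n : ℕ} {K : Type*} [Field K] (τ : MonomialOrder (Fin n))
    (I : Ideal (MvPolynomial (Fin n) K)) : Ideal (MvPolynomial (Fin n) K) :=
  Ideal.span (τ.leadingTerm '' (I : Set (MvPolynomial (Fin n) K)))

/-- `I` is `𝔪`-primary, where `𝔪 = (x₁, …, xₙ)` is the ideal generated by the variables. -/
def IsMPrimary {n : ℕ} {K : Type*} [Field K] (I : Ideal (MvPolynomial (Fin n) K)) : Prop :=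
  I.IsPrimary ∧ I.radical = Ideal.span (Set.range X)

/-- The homogeneous component `(S/I)_i` of `S/I`: the residue classes of the homogeneous
polynomials of degree `i`. -/
def quotientPart {n : ℕ} {K : Type*} [Field K] (I : Ideal (MvPolynomial (Fin n) K)) (i : ℕ) :
    Submodule K (MvPolynomial (Fin n) K ⧸ I) :=
  (homogeneousSubmodule (Fin n) K i).map (Ideal.Quotient.mkₐ K I).toLinearMap

theorem quotientPart_pow_mul_mem {n : ℕ} {K : Type*} [Field K]
    (I : Ideal (MvPolynomial (Fin n) K)) {l : MvPolynomial (Fin n) K ⧸ I}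
    (hl : l ∈ quotientPart I 1) (i k : ℕ) {f : MvPolynomial (Fin n) K ⧸ I}
    (hf : f ∈ quotientPart I i) : l ^ k * f ∈ quotientPart I (i + k) := by
  obtain ⟨p, hp, rfl⟩ := hl
  obtain ⟨q, hq, rfl⟩ := hf
  refine ⟨p ^ k * q, ?_, by simp⟩
  have h : (p ^ k * q).IsHomogeneous (1 * k + i) :=
    (IsHomogeneous.pow (show p.IsHomogeneous 1 from hp) k).mul hq
  have e : 1 * k + i = i + k := by omega
  rw [e] at h
  exact h

/-- For `l ∈ (S/I)_1`, the multiplication map `(S/I)_i → (S/I)_{i+k}`, `f ↦ l ^ k * f`. -/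
def mulPow {n : ℕ} {K : Type*} [Field K] (I : Ideal (MvPolynomial (Fin n) K))
    (l : quotientPart I 1) (i k : ℕ) : quotientPart I i →ₗ[K] quotientPart I (i + k) :=
  (LinearMap.mulLeft K ((l : MvPolynomial (Fin n) K ⧸ I) ^ k)).restrict
    fun _ hf => quotientPart_pow_mul_mem I l.2 i k hf

/-- A linear map has maximal rank if it is injective or surjective. -/
def HasMaximalRank {K V W : Type*} [Field K] [AddCommGroup V] [Module K V] [AddCommGroup W]
    [Module K W] (φ : V →ₗ[K] W) : Prop :=
  Function.Injective φ ∨ Function.Surjective φ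

/-- `l ∈ (S/I)_1` is a weak Lefschetz element on `S/I`. -/
def IsWeakLefschetzElement {n : ℕ} {K : Type*} [Field K] (I : Ideal (MvPolynomial (Fin n) K))
    (l : quotientPart I 1) : Prop :=
  ∀ i : ℕ, HasMaximalRank (mulPow I l i 1)

/-- `l ∈ (S/I)_1` is a strong Lefschetz element on `S/I`. -/
def IsStrongLefschetzElement {n : ℕ} {K : Type*} [Field K] (I : Ideal (MvPolynomial (Fin n) K))
    (l : quotientPart I 1) : Prop :=
  ∀ i k : ℕ, 1 ≤ k → HasMaximalRank (mulPow I l i k)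

/-- `S/I` has the weak Lefschetz property. -/
def HasWeakLefschetz {n : ℕ} {K : Type*} [Field K] (I : Ideal (MvPolynomial (Fin n) K)) : Prop :=
  ∃ l : quotientPart I 1, IsWeakLefschetzElement I l

/-- `S/I` has the strong Lefschetz property. -/
def HasStrongLefschetz {n : ℕ} {K : Type*} [Field K] (I : Ideal (MvPolynomial (Fin n) K)) :
    Prop :=
  ∃ l : quotientPart I 1, IsStrongLefschetzElement I l

end

/-!
Let `J` be the initial ideal of `I`, and let `B` be the set of standard monomials, those that are
not leading monomials of elements of `I`. The monomials in `B` of degree `i` form a basis both of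
`(S/I)_i` and of `(S/J)_i`, so multiplication by the `k`-th power of `l = ∑ aⱼ xⱼ` is given on
either side by a matrix with the same index sets, whose entries are polynomials in the `aⱼ`
(`lefschetzMatrix`, `IsNormalForm.toMatrix_mulPow`).

Regard the `aⱼ` as variables and multiply the column indexed by `b ∈ B` by the monomial `a^b`. The
entry in row `c` then has, for `I` as well as for `J`, only exponents `γ ≽ c`, because reducing
`x^γ` modulo `I` produces only monomials `≼ γ`. Its coefficient at the exponent `c` is that of
`x^c` in `x^b (x₁ + ⋯ + xₙ)^k`, the same for `I` and `J`; for `J` there is no other term. Hence a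
square minor with rows `R` has the same coefficient `d` at the exponent `∑ R` for `I` and for `J`
(`IsNormalForm.coeff_det`), and for `J` it is the single term `d a^(∑ R)`. So a maximal minor that
is a nonzero polynomial for `J` is one for `I` (`det_ne_zero_of_det_initialIdeal_ne_zero`).

A Lefschetz element of `S/J` thus provides, for each `(i, k)` in question, a nonzero polynomial
whose nonvanishing at `a` forces maximal rank on `S/I`. As `I` is `𝔪`-primary, only finitely many
`(i, k)` have nonzero source and target, and over an infinite field the product of finitely many
nonzero polynomials is nonzero at some point (`exists_linearForm_hasMaximalRank`).
-/

open scoped MonomialOrder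

/-! ### Maximal rank and maximal minors -/

theorem injective_of_det_ne_zero {K V W ι κ : Type*} [Field K] [AddCommGroup V] [Module K V]
    [AddCommGroup W] [Module K W] [Fintype ι] [DecidableEq ι] [Fintype κ] [DecidableEq κ]
    (φ : V →ₗ[K] W) (b : Module.Basis ι K V) (c : Module.Basis κ K W) (f : ι → κ)
    (h : ((LinearMap.toMatrix b c φ).submatrix f id).det ≠ 0) : Function.Injective φ := by
  rw [← LinearMap.ker_eq_bot, LinearMap.ker_eq_bot']
  intro v hv
  have h1 : ((LinearMap.toMatrix b c φ).submatrix f id).mulVec (b.repr v) = 0 := by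
    have h2 := LinearMap.toMatrix_mulVec_repr b c φ v
    rw [hv] at h2
    ext i
    simpa [Matrix.mulVec, dotProduct] using congrFun h2 (f i)
  have := Matrix.eq_zero_of_mulVec_eq_zero h h1
  exact b.repr.map_eq_zero_iff.1 (DFunLike.coe_injective this)

theorem surjective_of_det_ne_zero {K V W ι κ : Type*} [Field K] [AddCommGroup V] [Module K V]
    [AddCommGroup W] [Module K W] [Fintype ι] [DecidableEq ι] [Fintype κ] [DecidableEq κ]
    (φ : V →ₗ[K] W) (b : Module.Basis ι K V) (c : Module.Basis κ K W) (g : κ → ι)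
    (h : ((LinearMap.toMatrix b c φ).submatrix id g).det ≠ 0) : Function.Surjective φ := by
  have h1 : IsUnit ((LinearMap.toMatrix b c φ).submatrix id g) :=
    (Matrix.isUnit_iff_isUnit_det _).2 h.isUnit
  -- The submatrix is that of `φ` composed with the map `c j ↦ b (g j)`.
  have h2 : LinearMap.toMatrix c c (φ ∘ₗ c.constr K (fun j => b (g j))) =
      (LinearMap.toMatrix b c φ).submatrix id g := by
    ext i j
    simp [LinearMap.toMatrix_apply]
  have h3 : Function.Surjective (φ ∘ₗ c.constr K (fun j => b (g j))) := by
    rw [← h2] at h1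
    have := (LinearMap.isUnit_toMatrix_iff c).1 h1
    exact ((Module.End.isUnit_iff _).1 this).2
  exact Function.Surjective.of_comp (g := c.constr K (fun j => b (g j))) (by simpa using h3)

theorem Matrix.exists_submatrix_det_ne_zero_of_linearIndependent_col {K ι κ : Type*} [Field K]
    [Fintype ι] [DecidableEq ι] [Fintype κ] (M : Matrix κ ι K) (h : LinearIndependent K M.col) :
    ∃ f : ι → κ, (M.submatrix f id).det ≠ 0 := by
  -- A maximal linearly independent family of rows has as many members as `M` has columns.
  obtain ⟨s, a, -, hsp, hli⟩ := exists_linearIndependent' K M.row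
  have hr : M.rank = Fintype.card ι := by
    rw [Matrix.rank_eq_finrank_span_cols]
    exact finrank_span_eq_card h
  have : Finite s := hli.finite
  have := Fintype.ofFinite s
  have hcard : Fintype.card ι = Fintype.card s := by
    rw [← hr, Matrix.rank_eq_finrank_span_row, ← hsp]
    exact finrank_span_eq_card hli
  let e := Fintype.equivOfCardEq hcard
  refine ⟨a ∘ e, ?_⟩
  have : LinearIndependent K (M.submatrix (a ∘ e) id).row := hli.comp e e.injective
  exact ((Matrix.isUnit_iff_isUnit_det _).1
    (Matrix.linearIndependent_rows_iff_isUnit.1 this)).ne_zero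

theorem exists_det_ne_zero_of_injective {K V W ι κ : Type*} [Field K] [AddCommGroup V]
    [Module K V] [AddCommGroup W] [Module K W] [Fintype ι] [DecidableEq ι] [Fintype κ]
    [DecidableEq κ] (φ : V →ₗ[K] W) (b : Module.Basis ι K V) (c : Module.Basis κ K W)
    (h : Function.Injective φ) :
    ∃ f : ι → κ, ((LinearMap.toMatrix b c φ).submatrix f id).det ≠ 0 := by
  apply Matrix.exists_submatrix_det_ne_zero_of_linearIndependent_col
  rw [← Matrix.mulVec_injective_iff]
  intro v w hvw
  obtain ⟨v, rfl⟩ := b.equivFun.surjective v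
  obtain ⟨w, rfl⟩ := b.equivFun.surjective w
  simp only [Module.Basis.equivFun_apply, LinearMap.toMatrix_mulVec_repr] at hvw
  rw [h (c.repr.injective (DFunLike.coe_injective hvw))]

theorem exists_det_ne_zero_of_surjective {K V W ι κ : Type*} [Field K] [AddCommGroup V]
    [Module K V] [AddCommGroup W] [Module K W] [Fintype ι] [DecidableEq ι] [Fintype κ]
    [DecidableEq κ] (φ : V →ₗ[K] W) (b : Module.Basis ι K V) (c : Module.Basis κ K W)
    (h : Function.Surjective φ) :
    ∃ g : κ → ι, ((LinearMap.toMatrix b c φ).submatrix id g).det ≠ 0 := by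
  have h1 : Function.Surjective (LinearMap.toMatrix b c φ).mulVec := by
    intro w
    obtain ⟨w, rfl⟩ := c.equivFun.surjective w
    obtain ⟨v, rfl⟩ := h w
    exact ⟨b.repr v, by simp [LinearMap.toMatrix_mulVec_repr]⟩
  obtain ⟨N, hN⟩ := Matrix.mulVec_surjective_iff_exists_right_inverse.1 h1
  have h2 : LinearIndependent K (LinearMap.toMatrix b c φ).transpose.col := by
    rw [← Matrix.mulVec_injective_iff]
    refine Function.LeftInverse.injective (g := N.transpose.mulVec) fun v => ?_
    rw [Matrix.mulVec_mulVec, ← Matrix.transpose_mul, hN]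
    simp
  obtain ⟨g, hg⟩ := Matrix.exists_submatrix_det_ne_zero_of_linearIndependent_col _ h2
  refine ⟨g, ?_⟩
  rwa [← Matrix.det_transpose, Matrix.transpose_submatrix, Matrix.transpose_transpose] at hg

/-! ### Lowest terms of products and determinants -/

/-- If every exponent of `F i` is at least `e i`, then every exponent of `∏ F i` is at least
`∑ e i`, and the coefficient at this lowest possible exponent is multiplicative. -/
theorem MonomialOrder.le_and_coeff_prod_of_le {σ R ι : Type*} [CommRing R] (τ : MonomialOrder σ)
    (s : Finset ι) (F : ι → MvPolynomial σ R) (e : ι → σ →₀ ℕ)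
    (h : ∀ i ∈ s, ∀ γ, coeff γ (F i) ≠ 0 → e i ≼[τ] γ) :
    (∀ γ, coeff γ (∏ i ∈ s, F i) ≠ 0 → (∑ i ∈ s, e i) ≼[τ] γ) ∧
      coeff (∑ i ∈ s, e i) (∏ i ∈ s, F i) = ∏ i ∈ s, coeff (e i) (F i) := by
  classical
  induction s using Finset.cons_induction with
  | empty =>
    refine ⟨fun γ _ => ?_, by simp⟩
    simp
  | cons a s ha ih =>
    obtain ⟨ih1, ih2⟩ := ih fun i hi => h i (Finset.mem_cons_of_mem hi)
    have ha' := h a (Finset.mem_cons_self a s)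
    simp only [Finset.prod_cons, Finset.sum_cons]
    constructor
    · intro γ hγ
      rw [coeff_mul] at hγ
      obtain ⟨x, hx, hx0⟩ := Finset.exists_ne_zero_of_sum_ne_zero hγ
      rw [← Finset.HasAntidiagonal.mem_antidiagonal.1 hx, map_add, map_add]
      exact add_le_add (ha' _ (left_ne_zero_of_mul hx0)) (ih1 _ (right_ne_zero_of_mul hx0))
    · rw [coeff_mul, Finset.sum_eq_single (e a, ∑ i ∈ s, e i), ih2]
      · rintro ⟨x, y⟩ hx hne
        by_contra hx0
        have h1 := ha' _ (left_ne_zero_of_mul hx0)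
        have h2 := ih1 _ (right_ne_zero_of_mul hx0)
        have h3 : x + y = e a + ∑ i ∈ s, e i := Finset.HasAntidiagonal.mem_antidiagonal.1 hx
        have h4 := congrArg τ.toSyn h3
        rw [map_add, map_add] at h4
        have h5 : τ.toSyn x = τ.toSyn (e a) := by
          refine le_antisymm ?_ h1
          by_contra hlt
          exact absurd h4 (add_lt_add_of_lt_of_le (not_le.1 hlt) h2).ne'
        have h6 := τ.toSyn.injective h5
        subst h6
        exact hne (Prod.ext rfl (add_left_cancel h3))
      · simp

/-- If all exponents in row `i` are at least `e i`, the coefficient of the determinant at the lowest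
possible exponent `∑ e i` is the determinant of the coefficients at the `e i`. -/
theorem MonomialOrder.coeff_det_of_le {σ R ι : Type*} [CommRing R] [Fintype ι] [DecidableEq ι]
    (τ : MonomialOrder σ) (Q : Matrix ι ι (MvPolynomial σ R)) (e : ι → σ →₀ ℕ)
    (h : ∀ i j γ, coeff γ (Q i j) ≠ 0 → e i ≼[τ] γ) :
    coeff (∑ i, e i) Q.det = (Matrix.of fun i j => coeff (e i) (Q i j)).det := by
  rw [← Matrix.det_transpose, Matrix.det_apply, ← Matrix.det_transpose, Matrix.det_apply,
    coeff_sum]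
  refine Finset.sum_congr rfl fun p _ => ?_
  have h1 := (τ.le_and_coeff_prod_of_le Finset.univ (fun i => Q i (p i)) e fun i _ => h i _).2
  simp only [Units.smul_def, zsmul_eq_mul, Matrix.transpose_apply, Matrix.of_apply]
  rw [← map_intCast (C : R →+* MvPolynomial σ R), coeff_C_mul, h1]

/-! ### Normal forms and bases of the quotient -/

/-- `nf β` is a normal form modulo `L` of the monomial `x^β`: a combination of monomials in `B`,
of the same degree as `x^β` and not above it in the order `τ`, and congruent to it modulo `L`.
The last field says that the monomials in `B` are linearly independent modulo `L`. Only the values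
of the normal form on monomials are recorded; it is meant to be extended linearly. -/
structure IsNormalForm {n : ℕ} {K : Type*} [Field K] (τ : MonomialOrder (Fin n))
    (L : Ideal (MvPolynomial (Fin n) K)) (B : Set (Fin n →₀ ℕ))
    (nf : (Fin n →₀ ℕ) → MvPolynomial (Fin n) K) : Prop where
  isHomogeneous : ∀ β, (nf β).IsHomogeneous β.degree
  mem_of_coeff_ne_zero : ∀ β c, coeff c (nf β) ≠ 0 → c ∈ B
  sub_mem : ∀ β, monomial β 1 - nf β ∈ L
  le_of_coeff_ne_zero : ∀ β c, coeff c (nf β) ≠ 0 → c ≼[τ] β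
  eq_zero_of_mem : ∀ r ∈ L, (∀ c, coeff c r ≠ 0 → c ∈ B) → r = 0

/-- The exponents in `B` of total degree `i`. -/
abbrev DegreePart {n : ℕ} (B : Set (Fin n →₀ ℕ)) (i : ℕ) : Type :=
  {c : Fin n →₀ ℕ // c ∈ B ∧ c.degree = i}

instance {n : ℕ} (B : Set (Fin n →₀ ℕ)) (i : ℕ) : Finite (DegreePart B i) :=
  ((Finsupp.finite_of_degree_eq i).subset fun _ h => h.2 :
    {c : Fin n →₀ ℕ | c ∈ B ∧ c.degree = i}.Finite)

noncomputable instance {n : ℕ} (B : Set (Fin n →₀ ℕ)) (i : ℕ) : Fintype (DegreePart B i) :=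
  Fintype.ofFinite _

/-- The class of a monomial, as an element of a homogeneous component of the quotient. -/
noncomputable def monomialClass {n : ℕ} {K : Type*} [Field K] (L : Ideal (MvPolynomial (Fin n) K))
    (B : Set (Fin n →₀ ℕ)) (i : ℕ) (c : DegreePart B i) : quotientPart L i :=
  ⟨Ideal.Quotient.mk L (monomial c.1 1), monomial c.1 1,
    isHomogeneous_monomial _ c.2.2, by simp⟩

theorem quotient_mk_smul {n : ℕ} {K : Type*} [Field K] (L : Ideal (MvPolynomial (Fin n) K)) (r : K)
    (p : MvPolynomial (Fin n) K) : Ideal.Quotient.mk L (r • p) = r • Ideal.Quotient.mk L p :=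
  map_smul (Ideal.Quotient.mkₐ K L) r p

namespace IsNormalForm

variable {n : ℕ} {K : Type*} [Field K] {τ : MonomialOrder (Fin n)}
  {L : Ideal (MvPolynomial (Fin n) K)} {B : Set (Fin n →₀ ℕ)}
  {nf : (Fin n →₀ ℕ) → MvPolynomial (Fin n) K}

/-- A monomial in `B` is its own normal form. -/
theorem apply_of_mem (h : IsNormalForm τ L B nf) {c : Fin n →₀ ℕ} (hc : c ∈ B) :
    nf c = monomial c 1 := by
  refine (sub_eq_zero.1 (h.eq_zero_of_mem _ (h.sub_mem c) fun d hd => ?_)).symm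
  by_cases hdc : c = d
  · exact hdc ▸ hc
  · refine h.mem_of_coeff_ne_zero c d fun h0 => hd ?_
    classical
    rw [coeff_sub, h0, coeff_monomial, if_neg hdc, sub_zero]

theorem mk_monomial (h : IsNormalForm τ L B nf) (i : ℕ) {β : Fin n →₀ ℕ} (hβ : β.degree = i) :
    Ideal.Quotient.mk L (monomial β 1) =
      ∑ c : DegreePart B i, coeff c.1 (nf β) • Ideal.Quotient.mk L (monomial c.1 1) := by
  have h1 : nf β = ∑ c : DegreePart B i, coeff c.1 (nf β) • monomial c.1 (1 : K) := by
    classical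
    ext d
    simp only [coeff_sum, coeff_smul, coeff_monomial, smul_eq_mul, mul_ite, mul_one, mul_zero]
    by_cases hd : coeff d (nf β) = 0
    · rw [hd]
      refine (Finset.sum_eq_zero fun c _ => ?_).symm
      split_ifs with hcd
      · rw [hcd, hd]
      · rfl
    · have hdi : d.degree = i := by
        by_contra hne
        exact hd ((h.isHomogeneous β).coeff_eq_zero (by rwa [hβ]))
      rw [Finset.sum_eq_single (⟨d, h.mem_of_coeff_ne_zero β d hd, hdi⟩ : DegreePart B i)]
      · simp
      · intro c _ hc
        exact if_neg fun hcd => hc (Subtype.ext hcd)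
      · simp
  rw [Ideal.Quotient.eq.2 (h.sub_mem β)]
  conv_lhs => rw [h1]
  simp only [map_sum, quotient_mk_smul]

/-- A relation between the classes is an element of `L` supported in `B`, hence zero. -/
theorem linearIndependent (h : IsNormalForm τ L B nf) (i : ℕ) :
    LinearIndependent K (monomialClass L B i) := by
  classical
  rw [Fintype.linearIndependent_iff]
  intro g hg c
  have h1 := congrArg (Subtype.val) hg
  simp only [Submodule.coe_sum, Submodule.coe_smul, monomialClass, ZeroMemClass.coe_zero,
    ← quotient_mk_smul] at h1
  rw [← map_sum] at h1
  have hcoeff : ∀ d, coeff d (∑ c : DegreePart B i, g c • monomial c.1 (1 : K)) =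
      ∑ c : DegreePart B i, if c.1 = d then g c else 0 := by
    intro d
    simp [coeff_sum, coeff_monomial]
  have h2 := h.eq_zero_of_mem _ (Ideal.Quotient.eq_zero_iff_mem.1 h1) fun d hd => by
    rw [hcoeff] at hd
    obtain ⟨c, -, hc⟩ := Finset.exists_ne_zero_of_sum_ne_zero hd
    have : c.1 = d := by
      by_contra hne
      exact hc (if_neg hne)
    exact this ▸ c.2.1
  have h3 := hcoeff c.1
  rw [h2, coeff_zero, Finset.sum_eq_single c (fun d _ hd => if_neg fun hcd => hd (Subtype.ext hcd))
    (by simp)] at h3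
  simpa using h3.symm

/-- A homogeneous polynomial is congruent to the combination of the normal forms of its
monomials. -/
theorem top_le_span (h : IsNormalForm τ L B nf) (i : ℕ) :
    ⊤ ≤ Submodule.span K (Set.range (monomialClass L B i)) := by
  rintro ⟨x, p, hp, rfl⟩ -
  have hp' : p.IsHomogeneous i := hp
  have h1 : ∀ β : p.support, β.1.degree = i := fun β => by
    by_contra hne
    exact mem_support_iff.1 β.2 (hp'.coeff_eq_zero hne)
  have h2 : (⟨(Ideal.Quotient.mkₐ K L).toLinearMap p, p, hp, rfl⟩ : quotientPart L i) =
      ∑ β : p.support, coeff β.1 p • ∑ c : DegreePart B i,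
        coeff c.1 (nf β) • monomialClass L B i c := by
    apply Subtype.ext
    simp only [Submodule.coe_sum, Submodule.coe_smul, monomialClass]
    simp_rw [fun β : p.support => (h.mk_monomial i (h1 β)).symm]
    conv_lhs => rw [p.as_sum, ← Finset.sum_coe_sort]
    rw [AlgHom.toLinearMap_apply, Ideal.Quotient.mkₐ_eq_mk, map_sum]
    refine Finset.sum_congr rfl fun β _ => ?_
    rw [← quotient_mk_smul, smul_monomial, smul_eq_mul, mul_one]
  rw [h2]
  exact Submodule.sum_mem _ fun β _ => Submodule.smul_mem _ _ <| Submodule.sum_mem _ fun c _ =>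
    Submodule.smul_mem _ _ <| Submodule.subset_span ⟨c, rfl⟩

/-- The basis of `(S/L)_i` given by the classes of the monomials in `B` of degree `i`. -/
noncomputable def basis (h : IsNormalForm τ L B nf) (i : ℕ) :
    Module.Basis (DegreePart B i) K (quotientPart L i) :=
  Module.Basis.mk (h.linearIndependent i) (h.top_le_span i)

theorem basis_apply (h : IsNormalForm τ L B nf) (i : ℕ) (c : DegreePart B i) :
    h.basis i c = monomialClass L B i c := by
  rw [basis, Module.Basis.mk_apply]

end IsNormalForm

/-! ### The matrix of multiplication by a power of a linear form -/

/-- The linear form `∑ aⱼ xⱼ`, as an element of `(S/L)_1`. -/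
noncomputable def linearFormClass {n : ℕ} {K : Type*} [Field K]
    (L : Ideal (MvPolynomial (Fin n) K)) (a : Fin n → K) : quotientPart L 1 :=
  ⟨Ideal.Quotient.mk L (∑ j, a j • X j), ∑ j, a j • X j,
    Submodule.sum_mem _ fun j _ => Submodule.smul_mem _ _ (isHomogeneous_X K j), rfl⟩

theorem linearFormClass_surjective {n : ℕ} {K : Type*} [Field K]
    (L : Ideal (MvPolynomial (Fin n) K)) : Function.Surjective (linearFormClass L) := by
  rintro ⟨x, p, hp, rfl⟩
  have hp' := hp
  rw [SetLike.mem_coe, homogeneousSubmodule_one_eq_span_X,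
    Submodule.mem_span_range_iff_exists_fun] at hp'
  obtain ⟨a, ha⟩ := hp'
  exact ⟨a, Subtype.ext (congrArg (Ideal.Quotient.mk L) ha)⟩

/-- The matrix of multiplication by `(∑ aⱼ xⱼ) ^ k` from degree `i` to degree `i + k`, in the bases
given by `B`, with polynomials in the indeterminates `aⱼ` as entries. The `aⱼ` are represented by
the variables of `MvPolynomial (Fin n) K` itself, which allows comparing the exponents of the
entries with elements of `B`. The coefficient of `a^α x^α` in `(∑ aⱼ xⱼ) ^ k` is written as the
coefficient of `x^α` in `(∑ xⱼ) ^ k`. -/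
noncomputable def lefschetzMatrix {n : ℕ} {K : Type*} [Field K] (B : Set (Fin n →₀ ℕ))
    (nf : (Fin n →₀ ℕ) → MvPolynomial (Fin n) K) (i k : ℕ) :
    Matrix (DegreePart B (i + k)) (DegreePart B i) (MvPolynomial (Fin n) K) :=
  Matrix.of fun c b => ∑ α ∈ ((∑ j, X j : MvPolynomial (Fin n) K) ^ k).support,
    monomial α (coeff α ((∑ j, X j : MvPolynomial (Fin n) K) ^ k) * coeff c.1 (nf (α + b.1)))

/-- After the column of `b` is multiplied by `x^b`, a term `x^γ` of the entry in row `c` comes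
from the appearance of `x^c` in the normal form of `x^γ`. -/
theorem coeff_apply_ne_zero_of_coeff_mul_ne_zero {n : ℕ} {K : Type*} [Field K]
    {B : Set (Fin n →₀ ℕ)} (nf : (Fin n →₀ ℕ) → MvPolynomial (Fin n) K) {i k : ℕ}
    (c : DegreePart B (i + k)) (b : DegreePart B i) (γ : Fin n →₀ ℕ)
    (hγ : coeff γ (monomial b.1 1 * lefschetzMatrix B nf i k c b) ≠ 0) :
    coeff c.1 (nf γ) ≠ 0 := by
  classical
  rw [lefschetzMatrix, Matrix.of_apply, Finset.mul_sum, coeff_sum] at hγ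
  obtain ⟨α, -, hα⟩ := Finset.exists_ne_zero_of_sum_ne_zero hγ
  rw [monomial_mul, coeff_monomial] at hα
  split_ifs at hα with hab
  · rw [← hab, add_comm b.1 α]
    exact right_ne_zero_of_mul (right_ne_zero_of_mul hα)
  · exact absurd rfl hα

theorem sum_smul_X_pow_eq {n : ℕ} {K : Type*} [Field K] (a : Fin n → K) (k : ℕ) :
    (∑ j, a j • X j : MvPolynomial (Fin n) K) ^ k =
      ∑ α ∈ ((∑ j, X j : MvPolynomial (Fin n) K) ^ k).support,
        monomial α (coeff α ((∑ j, X j : MvPolynomial (Fin n) K) ^ k) *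
          α.prod fun j m => a j ^ m) := by
  classical
  have key : ∀ α, coeff α ((∑ j, a j • X j : MvPolynomial (Fin n) K) ^ k) =
      coeff α ((∑ j, X j : MvPolynomial (Fin n) K) ^ k) * α.prod fun j m => a j ^ m := by
    intro α
    rw [coeff_linearCombination_X_pow_of_fintype, coeff_sum_X_pow_of_fintype]
    split_ifs <;> simp
  ext α
  rw [key, coeff_sum]
  simp only [coeff_monomial]
  rw [Finset.sum_ite_eq']
  split_ifs with hα
  · rfl
  · rw [notMem_support_iff.1 hα, zero_mul]

theorem degree_of_mem_support_sum_X_pow {n : ℕ} {K : Type*} [Field K] {k : ℕ} {α : Fin n →₀ ℕ}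
    (hα : α ∈ ((∑ j, X j : MvPolynomial (Fin n) K) ^ k).support) : α.degree = k := by
  rw [mem_support_iff, coeff_sum_X_pow_of_fintype] at hα
  by_contra hne
  exact hα (by rw [if_neg (show ¬ (α.sum fun _ m => m) = k from hne), Nat.cast_zero])

namespace IsNormalForm

variable {n : ℕ} {K : Type*} [Field K] {τ : MonomialOrder (Fin n)}
  {L : Ideal (MvPolynomial (Fin n) K)} {B : Set (Fin n →₀ ℕ)}
  {nf : (Fin n →₀ ℕ) → MvPolynomial (Fin n) K}

open Classical in
theorem toMatrix_mulPow (h : IsNormalForm τ L B nf) (a : Fin n → K) (i k : ℕ) :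
    LinearMap.toMatrix (h.basis i) (h.basis (i + k)) (mulPow L (linearFormClass L a) i k) =
      (lefschetzMatrix B nf i k).map (eval a) := by
  have key : ∀ b : DegreePart B i, mulPow L (linearFormClass L a) i k (monomialClass L B i b) =
      ∑ c : DegreePart B (i + k), eval a (lefschetzMatrix B nf i k c b) •
        monomialClass L B (i + k) c := by
    intro b
    apply Subtype.ext
    simp only [Submodule.coe_sum, Submodule.coe_smul, monomialClass, mulPow,
      LinearMap.coe_restrict_apply, LinearMap.mulLeft_apply, linearFormClass, lefschetzMatrix,
      Matrix.of_apply, map_sum (eval a), eval_monomial, Finset.sum_smul]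
    rw [← map_pow, ← map_mul, Finset.sum_comm, sum_smul_X_pow_eq, Finset.sum_mul, map_sum]
    refine Finset.sum_congr rfl fun α hα => ?_
    have hdeg : (α + b.1).degree = i + k := by
      rw [map_add, degree_of_mem_support_sum_X_pow hα, b.2.2, add_comm]
    rw [monomial_mul, mul_one, ← mul_one (_ * _), ← smul_eq_mul, ← smul_monomial,
      ← Ideal.Quotient.mkₐ_eq_mk K, map_smul, Ideal.Quotient.mkₐ_eq_mk,
      h.mk_monomial (i + k) hdeg, Finset.smul_sum]
    refine Finset.sum_congr rfl fun c _ => ?_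
    rw [smul_smul]
    congr 1
    ring
  ext c b
  rw [LinearMap.toMatrix_apply, Matrix.map_apply, basis_apply, key]
  simp_rw [← h.basis_apply]
  rw [Module.Basis.repr_sum_self (h.basis (i + k))
    fun c => eval a (lefschetzMatrix B nf i k c b)]

theorem le_of_coeff_mul_ne_zero (h : IsNormalForm τ L B nf) {i k : ℕ} (c : DegreePart B (i + k))
    (b : DegreePart B i) (γ : Fin n →₀ ℕ)
    (hγ : coeff γ (monomial b.1 1 * lefschetzMatrix B nf i k c b) ≠ 0) : c.1 ≼[τ] γ :=
  h.le_of_coeff_ne_zero _ _ (coeff_apply_ne_zero_of_coeff_mul_ne_zero nf c b γ hγ)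

/-- The coefficient of lowest possible exponent depends neither on the ideal nor on the normal
form. -/
theorem coeff_mul_lefschetzMatrix (h : IsNormalForm τ L B nf) {i k : ℕ}
    (c : DegreePart B (i + k)) (b : DegreePart B i) :
    coeff c.1 (monomial b.1 1 * lefschetzMatrix B nf i k c b) =
      coeff c.1 (monomial b.1 1 * (∑ j, X j : MvPolynomial (Fin n) K) ^ k) := by
  classical
  conv_rhs => rw [((∑ j, X j : MvPolynomial (Fin n) K) ^ k).as_sum]
  rw [lefschetzMatrix, Matrix.of_apply, Finset.mul_sum, Finset.mul_sum, coeff_sum, coeff_sum]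
  refine Finset.sum_congr rfl fun α _ => ?_
  rw [monomial_mul, monomial_mul, coeff_monomial, coeff_monomial]
  split_ifs with hab
  · rw [add_comm α, hab, h.apply_of_mem c.2.1]
    simp
  · rfl

/-- The minors of the matrix have, after scaling of the columns, a coefficient at the lowest
possible exponent that depends neither on the ideal nor on the normal form. -/
theorem coeff_det (h : IsNormalForm τ L B nf) {i k : ℕ} {ι : Type*} [Fintype ι] [DecidableEq ι]
    (f : ι → DegreePart B (i + k)) (g : ι → DegreePart B i) :
    coeff (∑ s, (f s).1)
      ((∏ s, monomial (g s).1 1) * ((lefschetzMatrix B nf i k).submatrix f g).det) =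
      (Matrix.of fun s t => coeff (f s).1
          (monomial (g t).1 1 * (∑ j, X j : MvPolynomial (Fin n) K) ^ k)).det := by
  rw [← Matrix.det_mul_row, τ.coeff_det_of_le _ fun s => (f s).1]
  · congr 1
    ext s t
    exact h.coeff_mul_lefschetzMatrix (f s) (g t)
  · exact fun s t γ hγ => h.le_of_coeff_mul_ne_zero (f s) (g t) γ hγ

end IsNormalForm

/-! ### Standard monomials and the initial ideal -/

/-- The standard monomials of `I`: the exponents that are not leading exponents of nonzero
elements of `I`. -/
def standardMonomials {n : ℕ} {K : Type*} [Field K] (τ : MonomialOrder (Fin n))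
    (I : Ideal (MvPolynomial (Fin n) K)) : Set (Fin n →₀ ℕ) :=
  {c | ∀ f ∈ I, f ≠ 0 → τ.degree f ≠ c}

section

variable {n : ℕ} {K : Type*} [Field K] (τ : MonomialOrder (Fin n))
  (I : Ideal (MvPolynomial (Fin n) K))

/-- The initial ideal consists of the polynomials none of whose monomials is standard. -/
theorem mem_initialIdeal_iff (p : MvPolynomial (Fin n) K) :
    p ∈ initialIdeal τ I ↔ ∀ c, coeff c p ≠ 0 → c ∉ standardMonomials τ I := by
  have h1 : initialIdeal τ I =
      Ideal.span ((fun s => monomial s (1 : K)) ''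
        (τ.degree '' ((I : Set (MvPolynomial (Fin n) K)) \ {0}))) := by
    rw [initialIdeal, τ.span_leadingTerm_eq_span_monomial', Set.image_image]
  rw [h1, mem_ideal_span_monomial_image]
  refine forall_congr' fun c => ?_
  rw [mem_support_iff]
  refine imp_congr_right fun _ => ⟨?_, fun h => ?_⟩
  · rintro ⟨_, ⟨f, ⟨hf, hf0⟩, rfl⟩, hle⟩ hc
    have hm : monomial (c - τ.degree f) (1 : K) ≠ 0 := by simp
    refine hc (monomial (c - τ.degree f) 1 * f) (I.mul_mem_left _ hf) (mul_ne_zero hm hf0) ?_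
    classical
    rw [τ.degree_mul hm hf0, τ.degree_monomial, if_neg one_ne_zero, tsub_add_cancel_of_le hle]
  · simp only [standardMonomials, Set.mem_ofPred_eq, not_forall, not_not] at h
    obtain ⟨f, hf, hf0, rfl⟩ := h
    exact ⟨_, ⟨f, ⟨hf, hf0⟩, rfl⟩, le_rfl⟩

/-- The remainder of `x^β` under division by all nonzero elements of `I`, cut down to its component
of degree `|β|`, is a normal form. -/
theorem exists_isNormalForm (hI : I.IsHomogeneous (homogeneousSubmodule (Fin n) K)) :
    ∃ nf, IsNormalForm τ I (standardMonomials τ I) nf := by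
  have key : ∀ β : Fin n →₀ ℕ, ∃ r : MvPolynomial (Fin n) K, monomial β 1 - r ∈ I ∧
      ∀ c, coeff c r ≠ 0 → c ∈ standardMonomials τ I ∧ c ≼[τ] β := by
    intro β
    obtain ⟨g, r, h1, h2, h3⟩ := τ.div_set (B := (I : Set (MvPolynomial (Fin n) K)) \ {0})
      (fun b hb => (τ.leadingCoeff_ne_zero_iff.2 hb.2).isUnit) (monomial β 1)
    have hr : r = monomial β 1 - g.sum fun b q => q * b.1 :=
      (sub_eq_of_eq_add' (by rw [h1, Finsupp.linearCombination_apply]; rfl)).symm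
    have hle : τ.degree r ≼[τ] β := by
      rw [hr]
      refine τ.degree_sub_le.trans (sup_le (τ.degree_monomial_le 1) ?_)
      refine τ.degree_sum_le.trans (Finset.sup_le fun b _ => ?_)
      rw [show (fun b q => q * b.1 : _ → _ → MvPolynomial (Fin n) K) b (g b) = b.1 * g b from
        mul_comm _ _]
      exact (h2 b).trans (τ.degree_monomial_le 1)
    refine ⟨r, ?_, fun c hc => ⟨fun f hf hf0 hfc => ?_, ?_⟩⟩
    · rw [hr, sub_sub_cancel]
      exact I.sum_mem fun b _ => I.mul_mem_left _ b.2.1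
    · exact h3 c (mem_support_iff.2 hc) f ⟨hf, hf0⟩ hfc.le
    · exact (τ.le_degree (mem_support_iff.2 hc)).trans hle
  choose r hr hc using key
  have hcomp : ∀ β c, coeff c (homogeneousComponent β.degree (r β)) ≠ 0 → coeff c (r β) ≠ 0 := by
    intro β c h h0
    rw [coeff_homogeneousComponent, h0, ite_self] at h
    exact h rfl
  refine ⟨fun β => homogeneousComponent β.degree (r β), fun β => ?_, fun β c h => ?_, fun β => ?_,
    fun β c h => ?_, fun p hp h => ?_⟩
  · exact homogeneousComponent_isHomogeneous _ _
  · exact (hc β c (hcomp β c h)).1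
  · have h1 := homogeneousComponent_mem_of_mem hI (hr β) β.degree
    rwa [map_sub, homogeneousComponent_eq_self (isHomogeneous_monomial _ rfl)] at h1
  · exact (hc β c (hcomp β c h)).2
  · by_contra hp0
    exact h (τ.degree p) (τ.coeff_degree_ne_zero_iff.2 hp0) p hp hp0 rfl

open Classical in
/-- Modulo the initial ideal, a monomial is its own normal form if it is standard, and is zero
otherwise. -/
theorem isNormalForm_initialIdeal :
    IsNormalForm τ (initialIdeal τ I) (standardMonomials τ I)
      fun β => if β ∈ standardMonomials τ I then monomial β 1 else 0 := by
  have hcoeff : ∀ β c : Fin n →₀ ℕ, coeff c (if β ∈ standardMonomials τ I then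
      monomial β (1 : K) else 0) ≠ 0 → c = β ∧ c ∈ standardMonomials τ I := by
    intro β c h
    split_ifs at h with hβ
    · rw [coeff_monomial] at h
      have : β = c := by
        by_contra hne
        exact h (if_neg hne)
      exact ⟨this.symm, this ▸ hβ⟩
    · exact absurd (coeff_zero c) h
  refine ⟨fun β => ?_, fun β c h => (hcoeff β c h).2, fun β => ?_,
    fun β c h => (hcoeff β c h).1 ▸ le_rfl, fun p hp h => ?_⟩
  · split_ifs
    · exact isHomogeneous_monomial _ rfl
    · exact isHomogeneous_zero _ _ _
  · split_ifs with hβ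
    · rw [sub_self]
      exact zero_mem _
    · rw [sub_zero, mem_initialIdeal_iff]
      intro c hc
      rw [coeff_monomial] at hc
      have : β = c := by
        by_contra hne
        exact hc (if_neg hne)
      exact this ▸ hβ
  · ext c
    by_contra hc
    exact (mem_initialIdeal_iff τ I p).1 hp c hc (h c hc)

theorem exists_forall_degree_lt_of_mem_standardMonomials (hI : IsMPrimary I) :
    ∃ d, ∀ c ∈ standardMonomials τ I, c.degree < d := by
  obtain ⟨d, hd⟩ := Ideal.exists_pow_le_of_le_radical_of_fg hI.2.ge (idealOfVars_fg (Fin n) K)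
  refine ⟨d, fun c hc => ?_⟩
  by_contra! hdc
  have hmem := hd ((monomial_mem_pow_idealOfVars_iff d c (one_ne_zero (α := K))).2 hdc)
  classical
  exact hc _ hmem (by simp) (by rw [τ.degree_monomial, if_neg one_ne_zero])

/-! ### Comparison of `S/I` with the quotient by the initial ideal -/

variable {τ I}

open Classical in
/-- For the initial ideal the scaled minor is a single term, so that it is nonzero only if its
coefficient is; this coefficient also occurs in the scaled minor for `I`. -/
theorem det_ne_zero_of_det_initialIdeal_ne_zero {nf : (Fin n →₀ ℕ) → MvPolynomial (Fin n) K}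
    (h : IsNormalForm τ I (standardMonomials τ I) nf) {i k : ℕ}
    {ι : Type*} [Fintype ι] [DecidableEq ι]
    (f : ι → DegreePart (standardMonomials τ I) (i + k))
    (g : ι → DegreePart (standardMonomials τ I) i)
    (hdet : ((lefschetzMatrix (standardMonomials τ I)
      (fun β => if β ∈ standardMonomials τ I then monomial β (1 : K) else 0) i k).submatrix
        f g).det ≠ 0) :
    ((lefschetzMatrix (standardMonomials τ I) nf i k).submatrix f g).det ≠ 0 := by
  have hJ := isNormalForm_initialIdeal τ I
  set nfJ : (Fin n →₀ ℕ) → MvPolynomial (Fin n) K :=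
    fun β => if β ∈ standardMonomials τ I then monomial β (1 : K) else 0 with hnfJ
  have hentry : ∀ s t, monomial (g t).1 1 * (lefschetzMatrix _ nfJ i k).submatrix f g s t =
      monomial (f s).1 1 * C (coeff (f s).1
        (monomial (g t).1 1 * (∑ j, X j : MvPolynomial (Fin n) K) ^ k)) := by
    intro s t
    rw [← hJ.coeff_mul_lefschetzMatrix, mul_comm (monomial (f s).1 1), C_mul_monomial, mul_one]
    ext γ
    rw [coeff_monomial]
    split_ifs with hγ
    · rw [← hγ]
      rfl
    · by_contra hne
      have h1 := coeff_apply_ne_zero_of_coeff_mul_ne_zero nfJ (f s) (g t) γ hne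
      simp only [hnfJ] at h1
      split_ifs at h1
      · rw [coeff_monomial] at h1
        exact h1 (if_neg (Ne.symm hγ))
      · exact h1 (coeff_zero _)
  have hprod : (∏ t, monomial (g t).1 1) * ((lefschetzMatrix _ nfJ i k).submatrix f g).det =
      (∏ s, monomial (f s).1 1) * C (Matrix.of fun s t => coeff (f s).1
          (monomial (g t).1 1 * (∑ j, X j : MvPolynomial (Fin n) K) ^ k)).det := by
    rw [← Matrix.det_mul_row, RingHom.map_det, ← Matrix.det_mul_column]
    congr 1
    ext1 s t
    exact hentry s t
  have hmon : ∀ g : ι → Fin n →₀ ℕ, ∏ t, monomial (g t) (1 : K) ≠ 0 := fun g =>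
    Finset.prod_ne_zero_iff.2 fun t _ => by simp
  intro h0
  have h1 := h.coeff_det f g
  rw [h0, mul_zero, coeff_zero] at h1
  rw [← h1, C_0, mul_zero] at hprod
  exact (mul_ne_zero (hmon _) hdet) hprod

theorem det_submatrix_map_eval {σ R ι κ η : Type*} [CommRing R] [Fintype ι] [DecidableEq ι]
    (M : Matrix κ η (MvPolynomial σ R)) (f : ι → κ) (g : ι → η) (a : σ → R) :
    ((M.map (eval a)).submatrix f g).det = eval a (M.submatrix f g).det := by
  rw [RingHom.map_det]
  rfl

theorem exists_polynomial_hasMaximalRank {nf : (Fin n →₀ ℕ) → MvPolynomial (Fin n) K}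
    (h : IsNormalForm τ I (standardMonomials τ I) nf) {i k : ℕ} {a : Fin n → K}
    (ha : HasMaximalRank (mulPow (initialIdeal τ I) (linearFormClass _ a) i k)) :
    ∃ D : MvPolynomial (Fin n) K, D ≠ 0 ∧
      ∀ a', eval a' D ≠ 0 → HasMaximalRank (mulPow I (linearFormClass I a') i k) := by
  classical
  have hJ := isNormalForm_initialIdeal τ I
  rcases ha with ha | ha
  · obtain ⟨f, hf⟩ := exists_det_ne_zero_of_injective _ (hJ.basis i) (hJ.basis (i + k)) ha
    rw [hJ.toMatrix_mulPow, det_submatrix_map_eval] at hf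
    refine ⟨_, det_ne_zero_of_det_initialIdeal_ne_zero h f id fun h0 => hf ?_, fun a' ha' => ?_⟩
    · rw [h0, map_zero]
    · refine Or.inl (injective_of_det_ne_zero _ (h.basis i) (h.basis (i + k)) f ?_)
      rwa [h.toMatrix_mulPow, det_submatrix_map_eval]
  · obtain ⟨g, hg⟩ := exists_det_ne_zero_of_surjective _ (hJ.basis i) (hJ.basis (i + k)) ha
    rw [hJ.toMatrix_mulPow, det_submatrix_map_eval] at hg
    refine ⟨_, det_ne_zero_of_det_initialIdeal_ne_zero h id g fun h0 => hg ?_, fun a' ha' => ?_⟩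
    · rw [h0, map_zero]
    · refine Or.inr (surjective_of_det_ne_zero _ (h.basis i) (h.basis (i + k)) g ?_)
      rwa [h.toMatrix_mulPow, det_submatrix_map_eval]

/-- `T` is the set of pairs `(i, k)` for which multiplication by `l ^ k` on degree `i` is required
to have maximal rank: `k = 1` for the weak and `k ≥ 1` for the strong Lefschetz property. -/
theorem exists_linearForm_hasMaximalRank [Infinite K]
    (hI : I.IsHomogeneous (homogeneousSubmodule (Fin n) K)) (hprim : IsMPrimary I)
    (T : Set (ℕ × ℕ)) (hJ : ∃ l : quotientPart (initialIdeal τ I) 1,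
      ∀ p ∈ T, HasMaximalRank (mulPow (initialIdeal τ I) l p.1 p.2)) :
    ∃ l : quotientPart I 1, ∀ p ∈ T, HasMaximalRank (mulPow I l p.1 p.2) := by
  classical
  obtain ⟨l, hl⟩ := hJ
  obtain ⟨a, rfl⟩ := linearFormClass_surjective _ l
  obtain ⟨nf, hnf⟩ := exists_isNormalForm τ I hI
  obtain ⟨d, hd⟩ := exists_forall_degree_lt_of_mem_standardMonomials τ I hprim
  -- In degrees at least `d` the quotient is zero, so only `i, k < d` impose a condition.
  have hsub : ∀ i, d ≤ i → Subsingleton (quotientPart I i) := by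
    intro i hi
    have : IsEmpty (DegreePart (standardMonomials τ I) i) :=
      ⟨fun c => absurd (hd c.1 c.2.1) (by rw [c.2.2]; exact hi.not_gt)⟩
    exact (hnf.basis i).repr.injective.subsingleton
  have hex : ∀ p : ℕ × ℕ, ∃ D : MvPolynomial (Fin n) K, D ≠ 0 ∧ (p ∈ T →
      ∀ a', eval a' D ≠ 0 → HasMaximalRank (mulPow I (linearFormClass I a') p.1 p.2)) := by
    intro p
    by_cases hp : p ∈ T
    · obtain ⟨D, hD0, hD⟩ := exists_polynomial_hasMaximalRank hnf (hl p hp)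
      exact ⟨D, hD0, fun _ => hD⟩
    · exact ⟨1, one_ne_zero, fun h => absurd h hp⟩
  choose D hD0 hD using hex
  have hprod : ∏ p ∈ Finset.range d ×ˢ Finset.range d, D p ≠ 0 :=
    Finset.prod_ne_zero_iff.2 fun p _ => hD0 p
  obtain ⟨a', ha'⟩ : ∃ a', eval a' (∏ p ∈ Finset.range d ×ˢ Finset.range d, D p) ≠ 0 := by
    by_contra! h0
    exact hprod (MvPolynomial.funext fun x => by rw [h0, map_zero])
  rw [map_prod, Finset.prod_ne_zero_iff] at ha'
  refine ⟨linearFormClass I a', fun p hp => ?_⟩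
  by_cases h1 : d ≤ p.1
  · have := hsub _ h1
    exact Or.inl (Function.injective_of_subsingleton _)
  by_cases h2 : d ≤ p.2
  · have := hsub (p.1 + p.2) (h2.trans (Nat.le_add_left _ _))
    exact Or.inr (Function.surjective_to_subsingleton _)
  · exact hD p hp a' (ha' p (by simp; omega))

end

theorem proposition2p9 {n : ℕ} {K : Type*} [Field K] [Infinite K]
    (τ : MonomialOrder (Fin n)) (I : Ideal (MvPolynomial (Fin n) K))
    (hI : I.IsHomogeneous (MvPolynomial.homogeneousSubmodule (Fin n) K))
    (hprim : IsMPrimary I) :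
    (HasWeakLefschetz (initialIdeal τ I) → HasWeakLefschetz I) ∧
      (HasStrongLefschetz (initialIdeal τ I) → HasStrongLefschetz I) := by
  refine ⟨fun ⟨l, hl⟩ => ?_, fun ⟨l, hl⟩ => ?_⟩
  · obtain ⟨l', hl'⟩ := exists_linearForm_hasMaximalRank hI hprim {p | p.2 = 1}
      ⟨l, by rintro ⟨i, k⟩ rfl; exact hl i⟩
    exact ⟨l', fun i => hl' (i, 1) rfl⟩
  · obtain ⟨l', hl'⟩ := exists_linearForm_hasMaximalRank hI hprim {p | 1 ≤ p.2}
      ⟨l, fun p hp => hl p.1 p.2 hp⟩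
    exact ⟨l', fun i k hk => hl' (i, k) hk⟩
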